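/- Let $c, q \in \mathbb{C}$ with $|q| < 1$. For $a, p \in \mathbb{C}$ with $|p|<1$ and an integer $n \ge 0$ write $(a;p)_n = \prod_{k=0}^{n-1} (1 - a p^k)$ (so $(a;p)_0 = 1$) and $(a;p)_\infty = \prod_{k=0}^{\infty} (1 - a p^k)$. Then the following series converges absolutely, and $$\sum_{r=0}^{\infty} \frac{(1 - c q^r)\,(c^2;q)_r\,(-c)^r\, q^{r^2}}{(q;q)_r} = (c^2 q; q^2)_\infty\,(c;q)_\infty .$$ -/

import Mathlib

/-- The finite `q`-shifted factorial `(a;q)_n = (1 - a)(1 - aq) ⋯ (1 - aq^(n-1))`. -/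
noncomputable def qPochhammer (a q : ℂ) (n : ℕ) : ℂ :=
  ∏ k ∈ Finset.range n, (1 - a * q ^ k)

/-- The infinite `q`-shifted factorial `(a;q)_∞ = ∏_{k ≥ 0} (1 - aq^k)`, for `|q| < 1`. -/
noncomputable def qPochhammerInf (a q : ℂ) : ℂ :=
  ∏' k : ℕ, (1 - a * q ^ k)

/-- The product defining `(a;q)_∞` converges for `|q| < 1`, so that no default value is used. -/
theorem hasProd_qPochhammerInf (a q : ℂ) (hq : ‖q‖ < 1) :
    HasProd (fun k : ℕ => 1 - a * q ^ k) (qPochhammerInf a q) := by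
  have h : Summable (fun k : ℕ => ‖-(a * q ^ k)‖) := by
    simpa [norm_mul, norm_pow] using
      (summable_geometric_of_lt_one (norm_nonneg q) hq).mul_left ‖a‖
  simpa [sub_eq_add_neg, qPochhammerInf] using (multipliable_one_add_of_summable h).hasProd

/-- `(a;q)_∞` is the limit of `(a;q)_n` as `n → ∞`. -/
theorem tendsto_qPochhammer (a q : ℂ) (hq : ‖q‖ < 1) :
    Filter.Tendsto (qPochhammer a q) Filter.atTop (nhds (qPochhammerInf a q)) :=
  (hasProd_qPochhammerInf a q hq).tendsto_prod_nat

open Filter Topology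

/-! Let F(c) be the sum of the series. Termwise, F(c) - (1 - c)(1 - c²q) F(cq) has partial sums in
closed form (`sum_seriesTerm_sub`) that tend to 0, so F(c) = (1 - c)(1 - c²q) F(cq). Iterating n
times gives F(c) = (c²q;q²)_n (c;q)_n F(cq^n), and F(cq^n) → F(0) = 1 by dominated convergence. -/

lemma qPochhammer_zero (a q : ℂ) : qPochhammer a q 0 = 1 := by
  simp [qPochhammer]

lemma qPochhammer_succ (a q : ℂ) (n : ℕ) :
    qPochhammer a q (n + 1) = qPochhammer a q n * (1 - a * q ^ n) := by
  simp [qPochhammer, Finset.prod_range_succ]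

lemma qPochhammer_succ_left (a q : ℂ) (n : ℕ) :
    qPochhammer a q (n + 1) = (1 - a) * qPochhammer (a * q) q n := by
  simp only [qPochhammer, Finset.prod_range_succ', pow_zero, mul_one]
  rw [mul_comm]
  congr 1
  exact Finset.prod_congr rfl fun k _ => by ring

lemma one_sub_mul_pow_ne_zero {q : ℂ} (hq : ‖q‖ < 1) (n : ℕ) : 1 - q * q ^ n ≠ 0 := by
  intro h
  have h1 : q ^ (n + 1) = 1 := by linear_combination -h
  have h2 : ‖q‖ ^ (n + 1) < 1 := pow_lt_one₀ (norm_nonneg q) hq n.succ_ne_zero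
  rw [← norm_pow, h1, norm_one] at h2
  exact lt_irrefl _ h2

lemma qPochhammer_self_ne_zero {q : ℂ} (hq : ‖q‖ < 1) (n : ℕ) : qPochhammer q q n ≠ 0 :=
  Finset.prod_ne_zero_iff.mpr fun k _ => one_sub_mul_pow_ne_zero hq k

lemma norm_qPochhammer_le {a q : ℂ} {A : ℝ} (ha : ‖a‖ ≤ A) (n : ℕ) :
    ‖qPochhammer a q n‖ ≤ ∏ k ∈ Finset.range n, (1 + A * ‖q‖ ^ k) := by
  rw [qPochhammer, norm_prod]
  refine Finset.prod_le_prod (fun _ _ => norm_nonneg _) fun k _ => ?_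
  calc ‖1 - a * q ^ k‖ ≤ ‖(1 : ℂ)‖ + ‖a * q ^ k‖ := norm_sub_le _ _
    _ ≤ 1 + A * ‖q‖ ^ k := by
      rw [norm_one, norm_mul, norm_pow]
      gcongr

/-- The summand of the series. -/
noncomputable def seriesTerm (q c : ℂ) (r : ℕ) : ℂ :=
  (1 - c * q ^ r) * qPochhammer (c ^ 2) q r * (-c) ^ r * q ^ (r ^ 2) / qPochhammer q q r

/-- A majorant, up to a constant, of the summands whose parameter has norm at most `C`. -/
noncomputable def termMajorant (q : ℂ) (C : ℝ) (r : ℕ) : ℝ :=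
  (∏ k ∈ Finset.range r, (1 + C ^ 2 * ‖q‖ ^ k)) * C ^ r * ‖q‖ ^ (r ^ 2) / ‖qPochhammer q q r‖

lemma termMajorant_nonneg (q : ℂ) {C : ℝ} (hC : 0 ≤ C) (r : ℕ) : 0 ≤ termMajorant q C r := by
  unfold termMajorant
  have : 0 ≤ ∏ k ∈ Finset.range r, (1 + C ^ 2 * ‖q‖ ^ k) :=
    Finset.prod_nonneg fun k _ => by positivity
  positivity

lemma termMajorant_succ (q : ℂ) (C : ℝ) (r : ℕ) :
    termMajorant q C (r + 1) =
      ((1 + C ^ 2 * ‖q‖ ^ r) * C * (‖q‖ * (‖q‖ ^ r) ^ 2) / ‖1 - q * q ^ r‖) *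
        termMajorant q C r := by
  unfold termMajorant
  rw [qPochhammer_succ, norm_mul, Finset.prod_range_succ, div_mul_div_comm]
  congr 1 <;> ring

/-- Ratio test: q^(r²) contributes |q|^(2r+1) to the ratio, which therefore tends to 0. -/
lemma summable_termMajorant {q : ℂ} (hq : ‖q‖ < 1) {C : ℝ} (hC : 0 ≤ C) :
    Summable (termMajorant q C) := by
  have hx : Tendsto (fun r : ℕ => ‖q‖ ^ r) atTop (𝓝 0) :=
    tendsto_pow_atTop_nhds_zero_of_lt_one (norm_nonneg q) hq
  have hz : Tendsto (fun r : ℕ => q ^ r) atTop (𝓝 0) :=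
    tendsto_pow_atTop_nhds_zero_of_norm_lt_one hq
  have hden : Tendsto (fun r : ℕ => ‖1 - q * q ^ r‖) atTop (𝓝 1) := by
    simpa using ((hz.const_mul q).const_sub 1).norm
  have hratio : Tendsto (fun r : ℕ =>
      (1 + C ^ 2 * ‖q‖ ^ r) * C * (‖q‖ * (‖q‖ ^ r) ^ 2) / ‖1 - q * q ^ r‖) atTop (𝓝 0) := by
    have h := ((((hx.const_mul (C ^ 2)).const_add 1).mul_const C).mul
      ((hx.pow 2).const_mul ‖q‖)).div hden one_ne_zero
    simpa [Pi.div_def] using h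
  refine summable_of_ratio_norm_eventually_le (r := 1 / 2) (by norm_num) ?_
  filter_upwards [hratio.eventually_le_const (show (0 : ℝ) < 1 / 2 by norm_num)] with r hr
  rw [Real.norm_of_nonneg (termMajorant_nonneg q hC _),
    Real.norm_of_nonneg (termMajorant_nonneg q hC _), termMajorant_succ]
  exact mul_le_mul_of_nonneg_right hr (termMajorant_nonneg q hC r)

/-- The bound sees c only through C, so it is uniform along c, cq, cq², …. -/
lemma norm_seriesTerm_le {q c : ℂ} (hq : ‖q‖ < 1) {C : ℝ} (hc : ‖c‖ ≤ C) (r : ℕ) :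
    ‖seriesTerm q c r‖ ≤ (1 + C) * termMajorant q C r := by
  have hC : 0 ≤ C := (norm_nonneg c).trans hc
  have hfac : ‖1 - c * q ^ r‖ ≤ 1 + C := by
    refine (norm_sub_le _ _).trans ?_
    rw [norm_one, norm_mul, norm_pow]
    have : ‖c‖ * ‖q‖ ^ r ≤ C * 1 :=
      mul_le_mul hc (pow_le_one₀ (norm_nonneg q) hq.le) (by positivity) hC
    linarith
  have hP : ‖qPochhammer (c ^ 2) q r‖ ≤ ∏ k ∈ Finset.range r, (1 + C ^ 2 * ‖q‖ ^ k) :=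
    norm_qPochhammer_le (by rw [norm_pow]; gcongr) r
  have hP0 := (norm_nonneg _).trans hP
  unfold seriesTerm termMajorant
  rw [norm_div, norm_mul, norm_mul, norm_mul, norm_pow, norm_pow, norm_neg, ← mul_div_assoc,
    ← mul_assoc, ← mul_assoc]
  gcongr

lemma summable_seriesTerm {q : ℂ} (hq : ‖q‖ < 1) (c : ℂ) : Summable (seriesTerm q c) :=
  Summable.of_norm_bounded ((summable_termMajorant hq (norm_nonneg c)).mul_left (1 + ‖c‖))
    fun r => norm_seriesTerm_le hq le_rfl r

/-- The closed form of the partial sums of `seriesTerm q c - (1 - c) (1 - c²q) seriesTerm q (cq)`. -/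
noncomputable def telescopedSum (q c : ℂ) (n : ℕ) : ℂ :=
  (1 - c) * qPochhammer (c ^ 2 * q) q n * (-c) ^ (n + 1) * q ^ ((n + 1) ^ 2) *
    (c ^ 2 * q ^ (n + 1) - (1 + c)) / qPochhammer q q n

lemma sum_seriesTerm_sub {q : ℂ} (hq : ‖q‖ < 1) (c : ℂ) (n : ℕ) :
    ∑ r ∈ Finset.range (n + 1),
        (seriesTerm q c r - (1 - c) * (1 - c ^ 2 * q) * seriesTerm q (c * q) r) =
      telescopedSum q c n := by
  induction n with
  | zero =>
    simp [seriesTerm, telescopedSum, qPochhammer_zero]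
    ring
  | succ n ih =>
    rw [Finset.sum_range_succ, ih]
    -- `h1` and `h2` express both shifted factorials through (c²q;q)_n; the factor 1 - c²q completes
    -- (c²q²;q)_(n+1) to (c²q;q)_(n+2).
    have h1 : qPochhammer (c ^ 2) q (n + 1) = (1 - c ^ 2) * qPochhammer (c ^ 2 * q) q n :=
      qPochhammer_succ_left _ _ _
    have h2 : (1 - c ^ 2 * q) * qPochhammer ((c * q) ^ 2) q (n + 1) =
        qPochhammer (c ^ 2 * q) q n * (1 - c ^ 2 * q * q ^ n) *
          (1 - c ^ 2 * q * q ^ (n + 1)) := by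
      rw [← qPochhammer_succ, ← qPochhammer_succ, qPochhammer_succ_left (c ^ 2 * q) q (n + 1)]
      ring_nf
    have hterm : (1 - c) * (1 - c ^ 2 * q) * seriesTerm q (c * q) (n + 1) =
        (1 - c) * (1 - c * q * q ^ (n + 1)) * (qPochhammer (c ^ 2 * q) q n *
          (1 - c ^ 2 * q * q ^ n) * (1 - c ^ 2 * q * q ^ (n + 1))) * (-(c * q)) ^ (n + 1) *
            q ^ ((n + 1) ^ 2) / qPochhammer q q (n + 1) := by
      rw [← h2, seriesTerm]
      ring
    rw [hterm]
    unfold seriesTerm telescopedSum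
    rw [h1, qPochhammer_succ q q n, qPochhammer_succ (c ^ 2 * q) q n]
    have hd := qPochhammer_self_ne_zero hq n
    have hd' := one_sub_mul_pow_ne_zero hq n
    have e1 : (-(c * q)) ^ (n + 1) = (-c) ^ (n + 1) * (q * q ^ n) := by
      rw [← neg_mul, mul_pow, pow_succ' q]
    have e2 : q ^ ((n + 1 + 1) ^ 2) = q ^ ((n + 1) ^ 2) * (q ^ 3 * (q ^ n) ^ 2) := by ring
    rw [e1, e2, pow_succ (-c) (n + 1), pow_succ' q (n + 1), pow_succ' q n]
    -- With x = q^n and the common factors opaque, a rational identity in c, q, x remains.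
    generalize qPochhammer (c ^ 2 * q) q n = P
    generalize (-c) ^ (n + 1) = S
    generalize q ^ ((n + 1) ^ 2) = T
    generalize qPochhammer q q n = D at *
    generalize q ^ n = x at *
    field_simp
    ring

lemma tendsto_telescopedSum {q : ℂ} (hq : ‖q‖ < 1) (c : ℂ) :
    Tendsto (telescopedSum q c) atTop (𝓝 0) := by
  have hM := (summable_termMajorant hq (norm_nonneg c)).tendsto_atTop_zero.const_mul
    (‖1 - c‖ * ‖c‖ * (‖c‖ ^ 2 + ‖1 + c‖))
  rw [mul_zero] at hM
  refine squeeze_zero_norm (fun n => ?_) hM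
  have hP : ‖qPochhammer (c ^ 2 * q) q n‖ ≤
      ∏ k ∈ Finset.range n, (1 + ‖c‖ ^ 2 * ‖q‖ ^ k) := by
    refine norm_qPochhammer_le ?_ n
    rw [norm_mul, norm_pow]
    exact mul_le_of_le_one_right (by positivity) hq.le
  have hP0 := (norm_nonneg _).trans hP
  have hQ : ‖q‖ ^ ((n + 1) ^ 2) ≤ ‖q‖ ^ (n ^ 2) :=
    pow_le_pow_of_le_one (norm_nonneg q) hq.le (by gcongr; omega)
  have hL : ‖c ^ 2 * q ^ (n + 1) - (1 + c)‖ ≤ ‖c‖ ^ 2 + ‖1 + c‖ := by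
    refine (norm_sub_le _ _).trans ?_
    rw [norm_mul, norm_pow, norm_pow]
    gcongr
    exact mul_le_of_le_one_right (by positivity) (pow_le_one₀ (norm_nonneg q) hq.le)
  calc ‖telescopedSum q c n‖
      = ‖1 - c‖ * ‖qPochhammer (c ^ 2 * q) q n‖ * ‖c‖ ^ (n + 1) * ‖q‖ ^ ((n + 1) ^ 2) *
          ‖c ^ 2 * q ^ (n + 1) - (1 + c)‖ / ‖qPochhammer q q n‖ := by
        simp only [telescopedSum, norm_div, norm_mul, norm_pow, norm_neg]
    _ ≤ ‖1 - c‖ * (∏ k ∈ Finset.range n, (1 + ‖c‖ ^ 2 * ‖q‖ ^ k)) * ‖c‖ ^ (n + 1) *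
          ‖q‖ ^ (n ^ 2) * (‖c‖ ^ 2 + ‖1 + c‖) / ‖qPochhammer q q n‖ := by
        gcongr
    _ = ‖1 - c‖ * ‖c‖ * (‖c‖ ^ 2 + ‖1 + c‖) * termMajorant q ‖c‖ n := by
        unfold termMajorant
        ring

lemma tsum_seriesTerm_eq {q : ℂ} (hq : ‖q‖ < 1) (c : ℂ) :
    ∑' r, seriesTerm q c r =
      (1 - c) * (1 - c ^ 2 * q) * ∑' r, seriesTerm q (c * q) r := by
  have hs := (summable_seriesTerm hq c).hasSum.sub
    ((summable_seriesTerm hq (c * q)).hasSum.mul_left ((1 - c) * (1 - c ^ 2 * q)))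
  -- The shift by 1 matches the closed form, which sums over `range (n + 1)`.
  have hlim := (tendsto_add_atTop_iff_nat 1).mpr hs.tendsto_sum_nat
  simp only [sum_seriesTerm_sub hq c] at hlim
  exact sub_eq_zero.mp (tendsto_nhds_unique hlim (tendsto_telescopedSum hq c))

lemma tsum_seriesTerm_eq_iterate {q : ℂ} (hq : ‖q‖ < 1) (c : ℂ) (n : ℕ) :
    ∑' r, seriesTerm q c r =
      qPochhammer (c ^ 2 * q) (q ^ 2) n * qPochhammer c q n *
        ∑' r, seriesTerm q (c * q ^ n) r := by
  induction n with
  | zero => simp [qPochhammer_zero]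
  | succ n ih =>
    rw [ih, tsum_seriesTerm_eq hq (c * q ^ n), qPochhammer_succ, qPochhammer_succ,
      mul_assoc c, ← pow_succ]
    ring

lemma tendsto_tsum_seriesTerm {q : ℂ} (hq : ‖q‖ < 1) (c : ℂ) :
    Tendsto (fun n : ℕ => ∑' r, seriesTerm q (c * q ^ n) r) atTop (𝓝 1) := by
  have hzero : ∑' r, seriesTerm q 0 r = 1 := by
    -- At c = 0 the factor (-c)^r kills every term except r = 0.
    rw [tsum_eq_single 0 fun r hr => by simp [seriesTerm, hr]]
    simp [seriesTerm, qPochhammer_zero]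
  have hc : Tendsto (fun n : ℕ => c * q ^ n) atTop (𝓝 0) := by
    simpa using (tendsto_pow_atTop_nhds_zero_of_norm_lt_one hq).const_mul c
  rw [← hzero]
  refine tendsto_tsum_of_dominated_convergence
    ((summable_termMajorant hq (norm_nonneg c)).mul_left (1 + ‖c‖)) (fun r => ?_)
    (Eventually.of_forall fun n r => norm_seriesTerm_le hq ?_ r)
  · have hcont : Continuous fun z : ℂ => seriesTerm q z r := by
      unfold seriesTerm qPochhammer
      fun_prop
    exact (hcont.tendsto 0).comp hc
  · rw [norm_mul, norm_pow]
    exact mul_le_of_le_one_right (norm_nonneg c) (pow_le_one₀ (norm_nonneg q) hq.le)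

theorem corollary3p3 (c q : ℂ) (hq : ‖q‖ < 1) :
    HasSum
      (fun r : ℕ =>
        (1 - c * q ^ r) * qPochhammer (c ^ 2) q r * (-c) ^ r * q ^ (r ^ 2) / qPochhammer q q r)
      (qPochhammerInf (c ^ 2 * q) (q ^ 2) * qPochhammerInf c q) := by
  have hq2 : ‖q ^ 2‖ < 1 := by
    rw [norm_pow]
    exact pow_lt_one₀ (norm_nonneg q) hq two_ne_zero
  have hlim := ((tendsto_qPochhammer (c ^ 2 * q) (q ^ 2) hq2).mul
    (tendsto_qPochhammer c q hq)).mul (tendsto_tsum_seriesTerm hq c)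
  simp only [← tsum_seriesTerm_eq_iterate hq c, mul_one] at hlim
  rw [← tendsto_nhds_unique tendsto_const_nhds hlim]
  exact (summable_seriesTerm hq c).hasSum
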